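/- A Lorentzian pre-length space (in the sense of Kunzinger and Sämann) is a set $M$ with a metric $\rho$, a preorder $J$ (write $x\le y$ for $(x,y)\in J$), a transitive relation $I\subset J$, and a function $d:M\times M\to[0,\infty]$, lower semi-continuous for the topology $\mathscr T$ of $\rho$, such that $d(x,y)=0$ if $(x,y)\notin J$, $d(x,y)>0$ if and only if $(x,y)\in I$, and $d(x,z)\ge d(x,y)+d(y,z)$ whenever $x\le y\le z$. A causal (timelike) curve is a nonconstant locally $\rho$-Lipschitz map $\gamma$ from an interval to $M$ such that $(\gamma(s),\gamma(t))\in J$ (respectively $\in I$) for all $s<t$; its length is the $\rho$-length. The space is causally path connected if any $x,y$ with $(x,y)\in I$ are joined by a timelike curve from $x$ to $y$ and any $x\ne y$ with $x\le y$ are joined by a causal curve from $x$ to $y$. It is $\rho$-compatible if every point has a neighborhood $U$ and a constant $C$ such that every causal curve contained in $U$ has length at most $C$. Write $J^+(K)=\{q:\exists p\in K,\ p\le q\}$ and $J^-(K)=\{q:\exists p\in K,\ q\le p\}$. A Lorentzian length space is a Lorentzian pre-length space that is causally path connected; locally causally closed (every point has a neighborhood $U$ such that if $p_n,q_n\in U$,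 $p_n\le q_n$, $p_n\to p$, $q_n\to q$, then $p\le q$); localizable; and such that $d(x,y)$ is, for all $x,y$, the supremum of the Lorentzian lengths $L_d$ of the causal curves from $x$ to $y$ ($0$ if there are none), where $L_d(\gamma)=\inf\sum_i d(\gamma(t_i),\gamma(t_{i+1}))$ over all partitions of the domain of $\gamma$. Localizable means that every point lies in an open set $\Omega$ such that: the causal curves in $\Omega$ have bounded length; there is a continuous $\omega:\Omega\times\Omega\to[0,\infty)$ making $\Omega$, with the restrictions of $\rho, I, J$, a Lorentzian pre-length space; every $y\in\Omega$ has points of $\Omega$ in both its $I$-future and its $I$-past; and for all $p\neq q$ in $\Omega$ with $p\le q$ there is a causal curve in $\Omega$ from $p$ to $q$ whose Lorentzian length is maximal among the causal curves in $\Omega$ from $p$ to $q$ and equals $\omega(p,q)\le d(p,q)$. **Theorem.** Let $(M,\rho,I,J,d)$ be a Lorentzian pre-length space that is causally path connected and $\rho$-compatible. Then the following are equivalent: - $(\star)$ (global hyperbolicity of $(M,\mathscr T,J)$) $J$ is a closed order, that is, $J$ is antisymmetric and closed in $M\times M$, and for every compact set $K$ the set $J^+(K)\cap J^-(K)$ is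 compact; - (b) ($\mathcal K$-global hyperbolicity) for every compact set $K$ the lengths of the causal curves with image in $K$ are bounded by a finite constant, and for all compact sets $K_1,K_2$ the causal emerald $J^+(K_1)\cap J^-(K_2)$ is compact. Every Lorentzian length space is causally path connected and $\rho$-compatible, so the equivalence holds for it. Moreover, property (b) depends only on $J$ and $\mathscr T$, and not on $\rho$, $I$ or $d$: if $(\rho_1,I_1,J,d_1)$ and $(\rho_2,I_2,J,d_2)$ are two causally path connected, respectively $\rho_1$- and $\rho_2$-compatible, Lorentzian pre-length space structures on the same set $M$ with the same relation $J$, and $\rho_1$ and $\rho_2$ induce the same topology, then (b) holds for the first if and only if it holds for the second. -/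

import Mathlib

open scoped ENNReal NNReal Topology

/-! ### Topological preordered spaces -/

/-- `J⁺(K)`, the set of points to the future of some point of `K`. -/
def CausalFuture {M : Type*} (J : M → M → Prop) (K : Set M) : Set M :=
  {q | ∃ p ∈ K, J p q}

/-- `J⁻(K)`, the set of points to the past of some point of `K`. -/
def CausalPast {M : Type*} (J : M → M → Prop) (K : Set M) : Set M :=
  {q | ∃ p ∈ K, J q p}

/-- Global hyperbolicity of a topological preordered space: `J` is a closed order, and the causally
convex hull of a compact set is compact. -/
def IsGloballyHyperbolic {M : Type*} [TopologicalSpace M] (J : M → M → Prop) : Prop :=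
  IsClosed {p : M × M | J p.1 p.2} ∧ IsPartialOrder M J ∧
    ∀ K : Set M, IsCompact K → IsCompact (CausalFuture J K ∩ CausalPast J K)

/-! ### Lorentzian pre-length spaces -/

/-- The axioms of a Lorentzian pre-length space on a metric space `M` with chronological relation
`I`, causal relation `J` and Lorentzian distance (time separation) `d`: `(M, I, J)` is a causal
space, and `d` is lower semi-continuous, vanishes off `J`, is positive exactly on `I` and satisfies
the reverse triangle inequality. -/
structure IsLorentzianPreLength {M : Type*} [MetricSpace M] (I J : M → M → Prop)
    (d : M → M → ℝ≥0∞) : Prop where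
  causal_refl : ∀ x, J x x
  causal_trans : ∀ x y z, J x y → J y z → J x z
  chron_trans : ∀ x y z, I x y → I y z → I x z
  causal_of_chron : ∀ x y, I x y → J x y
  lowerSemicontinuous : LowerSemicontinuous (fun p : M × M => d p.1 p.2)
  eq_zero : ∀ x y, ¬ J x y → d x y = 0
  pos_iff : ∀ x y, 0 < d x y ↔ I x y
  reverse_triangle : ∀ x y z, J x y → J y z → d x y + d y z ≤ d x z

/-- A nonconstant, locally Lipschitz curve `γ`, defined on the interval `s`, whose points are
related by `R` in the order of their parameters. For `R = J` this is a (future-directed) causal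
curve and for `R = I` a (future-directed) timelike curve. The values of `γ` off `s` play no
role. -/
structure IsDirectedCurve {M : Type*} [MetricSpace M] (R : M → M → Prop) (s : Set ℝ)
    (γ : ℝ → M) : Prop where
  ordConnected : s.OrdConnected
  nonconstant : ∃ t₁ ∈ s, ∃ t₂ ∈ s, γ t₁ ≠ γ t₂
  locallyLipschitz : LocallyLipschitzOn s γ
  related : ∀ t₁ ∈ s, ∀ t₂ ∈ s, t₁ < t₂ → R (γ t₁) (γ t₂)

/-- `γ`, restricted to `[a, b]`, is a directed curve from `x` to `y`. -/
def IsDirectedCurveFrom {M : Type*} [MetricSpace M] (R : M → M → Prop) (a b : ℝ) (γ : ℝ → M)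
    (x y : M) : Prop :=
  a < b ∧ IsDirectedCurve R (Set.Icc a b) γ ∧ γ a = x ∧ γ b = y

/-- All causal curves contained in `U` have length (with respect to the metric) bounded by
one finite constant. -/
def HasBoundedCausalLength {M : Type*} [MetricSpace M] (J : M → M → Prop) (U : Set M) : Prop :=
  ∃ C : ℝ≥0, ∀ (s : Set ℝ) (γ : ℝ → M), IsDirectedCurve J s γ → γ '' s ⊆ U →
    eVariationOn γ s ≤ C

/-- Non-total imprisonment, in the form of a bound on the lengths of the causal curves
contained in a compact set. -/
def IsNonTotallyImprisoning {M : Type*} [MetricSpace M] (J : M → M → Prop) : Prop :=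
  ∀ K : Set M, IsCompact K → HasBoundedCausalLength J K

/-- `𝒦`-global hyperbolicity: non-total imprisonment and compactness of the causal emeralds. -/
def IsKGloballyHyperbolic {M : Type*} [MetricSpace M] (J : M → M → Prop) : Prop :=
  IsNonTotallyImprisoning J ∧
    ∀ K₁ K₂ : Set M, IsCompact K₁ → IsCompact K₂ →
      IsCompact (CausalFuture J K₁ ∩ CausalPast J K₂)

/-- Chronologically related points are joined by timelike curves, and distinct causally related
points by causal curves. -/
def IsCausallyPathConnected {M : Type*} [MetricSpace M] (I J : M → M → Prop) : Prop :=
  (∀ x y, I x y → ∃ (a b : ℝ) (γ : ℝ → M), IsDirectedCurveFrom I a b γ x y) ∧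
    (∀ x y, J x y → x ≠ y → ∃ (a b : ℝ) (γ : ℝ → M), IsDirectedCurveFrom J a b γ x y)

/-- Compatibility with the metric: every point has a neighborhood in which the lengths of causal
curves are bounded. -/
def IsMetricCompatible {M : Type*} [MetricSpace M] (J : M → M → Prop) : Prop :=
  ∀ x : M, ∃ U ∈ 𝓝 x, HasBoundedCausalLength J U

/-! ### Lorentzian length spaces -/

/-- Every point has a neighborhood `U` on whose closure the causal relation is closed under
limits of sequences of pairs in `U`. -/
def IsLocallyCausallyClosed {M : Type*} [MetricSpace M] (J : M → M → Prop) : Prop :=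
  ∀ x : M, ∃ U ∈ 𝓝 x, ∀ (u v : ℕ → M) (p q : M), (∀ n, u n ∈ U) → (∀ n, v n ∈ U) →
    (∀ n, J (u n) (v n)) → Filter.Tendsto u Filter.atTop (𝓝 p) →
    Filter.Tendsto v Filter.atTop (𝓝 q) → J p q

/-- The Lorentzian length of `γ` on `[a, b]`: the infimum over all partitions
`a = t 0 < ⋯ < t N = b` of the sums of the Lorentzian distances. -/
noncomputable def lorentzianLength {M : Type*} (d : M → M → ℝ≥0∞) (a b : ℝ) (γ : ℝ → M) : ℝ≥0∞ :=
  ⨅ (N : ℕ) (t : ℕ → ℝ) (_ : t 0 = a ∧ t N = b ∧ ∀ i < N, t i < t (i + 1)),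
    ∑ i ∈ Finset.range N, d (γ (t i)) (γ (t (i + 1)))

/-- The supremum of the Lorentzian lengths of the causal curves from `x` to `y` (and `0` if there
are none). -/
noncomputable def intrinsicDistance {M : Type*} [MetricSpace M] (J : M → M → Prop)
    (d : M → M → ℝ≥0∞) (x y : M) : ℝ≥0∞ :=
  ⨆ (a : ℝ) (b : ℝ) (γ : ℝ → M) (_ : IsDirectedCurveFrom J a b γ x y), lorentzianLength d a b γ

/-- `Ω` is a localizing neighborhood (of each of its points): it is open, causal curves in it have
bounded length, and the maximal Lorentzian length of causal curves in `Ω` is attained and is given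
by a continuous finite Lorentzian distance `ω` on `Ω`, with respect to the restricted metric and
relations; moreover every point of `Ω` has points of `Ω` in its chronological future and past. -/
def IsLocalizing {M : Type*} [MetricSpace M] (I J : M → M → Prop) (d : M → M → ℝ≥0∞)
    (Ω : Set M) : Prop :=
  IsOpen Ω ∧ HasBoundedCausalLength J Ω ∧
    ∃ ω : Ω → Ω → ℝ≥0,
      Continuous (fun p : Ω × Ω => ω p.1 p.2) ∧
      IsLorentzianPreLength (fun p q : Ω => I p q) (fun p q : Ω => J p q)
        (fun p q : Ω => (ω p q : ℝ≥0∞)) ∧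
      (∀ y : Ω, (∃ z : Ω, I y z) ∧ ∃ z : Ω, I z y) ∧
      ∀ p q : Ω, J p q → p ≠ q →
        ∃ (a b : ℝ) (γ : ℝ → M), IsDirectedCurveFrom J a b γ p q ∧ γ '' Set.Icc a b ⊆ Ω ∧
          (∀ (a' b' : ℝ) (σ : ℝ → M), IsDirectedCurveFrom J a' b' σ p q →
            σ '' Set.Icc a' b' ⊆ Ω → lorentzianLength d a' b' σ ≤ lorentzianLength d a b γ) ∧
          lorentzianLength d a b γ = ω p q ∧ (ω p q : ℝ≥0∞) ≤ d p q

/-- Every point has a localizing neighborhood. -/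
def IsLocalizable {M : Type*} [MetricSpace M] (I J : M → M → Prop) (d : M → M → ℝ≥0∞) : Prop :=
  ∀ x : M, ∃ Ω : Set M, x ∈ Ω ∧ IsLocalizing I J d Ω

/-! ### The quintuple `(M, ρ, I, J, d)` -/

/-- A Lorentzian pre-length space structure `(ρ, I, J, d)` on the set `M`. -/
structure LorentzianPreLengthSpace (M : Type*) where
  /-- the metric -/
  ρ : MetricSpace M
  /-- the chronological relation -/
  I : M → M → Prop
  /-- the causal relation -/
  J : M → M → Prop
  /-- the Lorentzian distance -/
  d : M → M → ℝ≥0∞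
  isPreLength : IsLorentzianPreLength I J d

namespace LorentzianPreLengthSpace

/-- The topology induced by the metric `ρ`. -/
abbrev topology {M : Type*} (S : LorentzianPreLengthSpace M) : TopologicalSpace M :=
  S.ρ.toPseudoMetricSpace.toUniformSpace.toTopologicalSpace

/-- The topological preordered space `(M, 𝒯, J)` is globally hyperbolic. -/
def GloballyHyperbolic {M : Type*} (S : LorentzianPreLengthSpace M) : Prop :=
  @IsGloballyHyperbolic M S.topology S.J

/-- `𝒦`-global hyperbolicity of the Lorentzian pre-length space. -/
def KGloballyHyperbolic {M : Type*} (S : LorentzianPreLengthSpace M) : Prop :=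
  @IsKGloballyHyperbolic M S.ρ S.J

/-- Causal path connectedness. -/
def CausallyPathConnected {M : Type*} (S : LorentzianPreLengthSpace M) : Prop :=
  @IsCausallyPathConnected M S.ρ S.I S.J

/-- `ρ`-compatibility. -/
def RhoCompatible {M : Type*} (S : LorentzianPreLengthSpace M) : Prop :=
  @IsMetricCompatible M S.ρ S.J

/-- Lorentzian length spaces: locally causally closed, causally path connected, localizable, and
the Lorentzian distance is the supremum of the Lorentzian lengths of the connecting causal
curves. -/
def IsLengthSpace {M : Type*} (S : LorentzianPreLengthSpace M) : Prop :=
  @IsLocallyCausallyClosed M S.ρ S.J ∧ S.CausallyPathConnected ∧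
    @IsLocalizable M S.ρ S.I S.J S.d ∧
    ∀ x y : M, S.d x y = @intrinsicDistance M S.ρ S.J S.d x y

end LorentzianPreLengthSpace

open Set Filter

/-! ### Curves on compact intervals -/

/-! From (⋆) to (b): antisymmetry and closedness of `J` make it locally convex on a compact set `K`:
a point of `K` causally between two points near `x` is itself near `x`
(`exists_isClosed_nhds_convex_subset`). Hence a causal curve in `K` that returns to a small
neighborhood of `x` has meanwhile stayed in a neighborhood where lengths are bounded. Finitely many
such neighborhoods cover `K`, and `eVariationOn_Icc_le_sum_of_closed_cover` bounds the length by the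
sum of their constants. Emeralds are closed subsets of causally convex hulls.

From (b) to (⋆): a failure of antisymmetry yields a closed causal curve, and running through it
repeatedly gives unbounded length in a compact set. Closedness of `J` follows from compactness of
the emeralds of convergent sequences together with their limits.

Since (⋆) involves only `J` and the topology, so does (b). -/

theorem LocallyLipschitzOn.congr_of_eqOn {X Y : Type*} [PseudoEMetricSpace X]
    [PseudoEMetricSpace Y] {s : Set X} {f g : X → Y} (hf : LocallyLipschitzOn s f)
    (h : EqOn f g s) : LocallyLipschitzOn s g := by
  intro x hx
  obtain ⟨K, t, ht, hK⟩ := hf hx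
  refine ⟨K, t ∩ s, inter_mem ht self_mem_nhdsWithin, fun u hu v hv => ?_⟩
  rw [← h hu.2, ← h hv.2]
  exact hK hu.1 hv.1

theorem LocallyLipschitzOn.Icc_concat {E : Type*} [PseudoEMetricSpace E] {a b c : ℝ} {f : ℝ → E}
    (hab : a ≤ b) (hbc : b ≤ c) (h₁ : LocallyLipschitzOn (Icc a b) f)
    (h₂ : LocallyLipschitzOn (Icc b c) f) : LocallyLipschitzOn (Icc a c) f := by
  intro x hx
  rcases lt_trichotomy x b with hxb | rfl | hxb
  · obtain ⟨K, t, ht, hK⟩ := h₁ ⟨hx.1, hxb.le⟩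
    refine ⟨K, t, ?_, hK⟩
    rwa [nhdsWithin_eq_nhdsWithin (mem_Iio.2 hxb) isOpen_Iio (t := Icc a c) (u := Icc a b)]
    ext y
    simp only [mem_inter_iff, mem_Icc, mem_Iio]
    constructor <;> rintro ⟨⟨h, h'⟩, h''⟩ <;> refine ⟨⟨h, ?_⟩, h''⟩ <;> linarith
  · obtain ⟨K₁, t₁, ht₁, hK₁⟩ := h₁ ⟨hab, le_rfl⟩
    obtain ⟨K₂, t₂, ht₂, hK₂⟩ := h₂ ⟨le_rfl, hbc⟩
    have m₁ := mem_of_mem_nhdsWithin (right_mem_Icc.2 hab) ht₁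
    have m₂ := mem_of_mem_nhdsWithin (left_mem_Icc.2 hbc) ht₂
    refine ⟨K₁ + K₂, t₁ ∩ Icc a x ∪ t₂ ∩ Icc x c, ?_, ?_⟩
    · rw [← Icc_union_Icc_eq_Icc hab hbc, nhdsWithin_union]
      exact ⟨mem_of_superset (inter_mem ht₁ self_mem_nhdsWithin) subset_union_left,
        mem_of_superset (inter_mem ht₂ self_mem_nhdsWithin) subset_union_right⟩
    -- Across the junction, compare through `f x`: as `u ≤ x ≤ v`, both partial distances are at
    -- most that from `u` to `v`, so the constants add.
    · have key : ∀ u ∈ t₁ ∩ Icc a x, ∀ v ∈ t₂ ∩ Icc x c,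
          edist (f u) (f v) ≤ (K₁ + K₂ : ℝ≥0) * edist u v := by
        intro u hu v hv
        have e₁ : edist u x ≤ edist u v := by
          rw [edist_dist, edist_dist, Real.dist_eq, Real.dist_eq]
          apply ENNReal.ofReal_le_ofReal
          rw [abs_sub_comm u x, abs_sub_comm u v, abs_of_nonneg (by linarith [hu.2.2]),
            abs_of_nonneg (by linarith [hu.2.2, hv.2.1])]
          linarith [hv.2.1]
        have e₂ : edist x v ≤ edist u v := by
          rw [edist_dist, edist_dist, Real.dist_eq, Real.dist_eq]
          apply ENNReal.ofReal_le_ofReal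
          rw [abs_sub_comm x v, abs_sub_comm u v, abs_of_nonneg (by linarith [hv.2.1]),
            abs_of_nonneg (by linarith [hu.2.2, hv.2.1])]
          linarith [hu.2.2]
        calc edist (f u) (f v) ≤ edist (f u) (f x) + edist (f x) (f v) := edist_triangle _ _ _
          _ ≤ K₁ * edist u x + K₂ * edist x v := add_le_add (hK₁ hu.1 m₁) (hK₂ m₂ hv.1)
          _ ≤ K₁ * edist u v + K₂ * edist u v := by gcongr
          _ = (K₁ + K₂ : ℝ≥0) * edist u v := by rw [ENNReal.coe_add, add_mul]
      rintro u (hu | hu) v (hv | hv)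
      · exact (hK₁ hu.1 hv.1).trans (by gcongr; exact le_self_add)
      · exact key u hu v hv
      · rw [edist_comm, edist_comm u]
        exact key v hv u hu
      · exact (hK₂ hu.1 hv.1).trans (by gcongr; exact le_add_self)
  · obtain ⟨K, t, ht, hK⟩ := h₂ ⟨hxb.le, hx.2⟩
    refine ⟨K, t, ?_, hK⟩
    rwa [nhdsWithin_eq_nhdsWithin (mem_Ioi.2 hxb) isOpen_Ioi (t := Icc a c) (u := Icc b c)]
    ext y
    simp only [mem_inter_iff, mem_Icc, mem_Ioi]
    constructor <;> rintro ⟨⟨h, h'⟩, h''⟩ <;> refine ⟨⟨?_, h'⟩, h''⟩ <;> linarith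

/-- If finitely many closed sets cover `[a, b]`, and the variation of `f` between any two points
of the `i`-th of these sets is at most `C i`, the variation of `f` on `[a, b]` is at most
`∑ i, C i`. -/
theorem eVariationOn_Icc_le_sum_of_closed_cover {ι E : Type*} [PseudoEMetricSpace E] (f : ℝ → E)
    (T : ι → Set ℝ) (hT : ∀ i, IsClosed (T i)) (C : ι → ℝ≥0∞)
    (hC : ∀ i, ∀ u ∈ T i, ∀ v ∈ T i, u ≤ v → eVariationOn f (Icc u v) ≤ C i) (b : ℝ)
    (s : Finset ι) : ∀ a, Icc a b ⊆ ⋃ i ∈ s, T i → eVariationOn f (Icc a b) ≤ ∑ i ∈ s, C i := by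
  classical
  induction s using Finset.strongInduction with
  | H s ih =>
    intro a hcov
    rcases lt_or_ge b a with hba | hab
    · simp [Icc_eq_empty (not_le.2 hba)]
    obtain ⟨i, hi, hai⟩ : ∃ i ∈ s, a ∈ T i := by simpa using hcov (left_mem_Icc.2 hab)
    have hcpt : IsCompact (T i ∩ Icc a b) := isCompact_Icc.inter_left (hT i)
    have hgr := hcpt.isGreatest_sSup ⟨a, hai, left_mem_Icc.2 hab⟩
    -- The last visit to `T i`, attained by compactness. Beyond `c` the set `T i` is no longer
    -- needed, which allows induction on the remaining sets.
    set c := sSup (T i ∩ Icc a b)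
    rw [← Finset.add_sum_erase s C hi]
    have hsplit : eVariationOn f (Icc a b)
        = eVariationOn f (Icc a c) + eVariationOn f (Icc c b) := by
      simpa using (eVariationOn.Icc_add_Icc f (s := univ) hgr.1.2.1 hgr.1.2.2 (mem_univ c)).symm
    rw [hsplit]
    refine add_le_add (hC i a hai c hgr.1.1 hgr.1.2.1) ?_
    rcases hgr.1.2.2.eq_or_lt with hcb | hcb
    · simp [hcb]
    refine ih _ (Finset.erase_ssubset hi) c ?_
    -- The remaining sets are only known to cover `Ioc c b`; their finite union is closed, so it
    -- contains `c` as well.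
    rw [← closure_Ioc hcb.ne]
    refine closure_minimal (fun t ht => ?_) (isClosed_biUnion_finset fun j _ => hT j)
    have htab : t ∈ Icc a b := ⟨hgr.1.2.1.trans ht.1.le, ht.2⟩
    obtain ⟨j, hj, htj⟩ : ∃ j ∈ s, t ∈ T j := by simpa using hcov htab
    simp only [mem_iUnion, Finset.mem_erase]
    refine ⟨j, ⟨?_, hj⟩, htj⟩
    rintro rfl
    exact (hgr.2 ⟨htj, htab⟩).not_gt ht.1

/-! ### Closed orders -/

/-- Tube lemma: for `q` outside the future of `K`, the open set of unrelated pairs contains `K ×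
{q}`, hence `K × W` for some neighborhood `W` of `q`. -/
theorem IsCompact.isClosed_causalFuture {M : Type*} [TopologicalSpace M] {J : M → M → Prop}
    (hJ : IsClosed {p : M × M | J p.1 p.2}) {K : Set M} (hK : IsCompact K) :
    IsClosed (CausalFuture J K) := by
  rw [← isOpen_compl_iff, isOpen_iff_eventually]
  intro q hq
  have := hK.eventually_forall_of_forall_eventually (x₀ := q) (P := fun q p => ¬ J p q)
    fun p hp => (hJ.isOpen_compl.preimage continuous_swap).mem_nhds fun h => hq ⟨p, hp, h⟩
  filter_upwards [this] with r hr
  rintro ⟨p, hp, h⟩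
  exact hr p hp h

theorem IsCompact.isClosed_causalPast {M : Type*} [TopologicalSpace M] {J : M → M → Prop}
    (hJ : IsClosed {p : M × M | J p.1 p.2}) {K : Set M} (hK : IsCompact K) :
    IsClosed (CausalPast J K) :=
  hK.isClosed_causalFuture (J := fun x y => J y x) (hJ.preimage continuous_swap)

/-- The emerald is closed and contained in the causally convex hull of `K₁ ∪ K₂`. -/
theorem IsGloballyHyperbolic.isCompact_emerald {M : Type*} [TopologicalSpace M] {J : M → M → Prop}
    (h : IsGloballyHyperbolic J) {K₁ K₂ : Set M} (h₁ : IsCompact K₁) (h₂ : IsCompact K₂) :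
    IsCompact (CausalFuture J K₁ ∩ CausalPast J K₂) := by
  refine (h.2.2 _ (h₁.union h₂)).of_isClosed_subset
    ((h₁.isClosed_causalFuture h.1).inter (h₂.isClosed_causalPast h.1)) ?_
  rintro q ⟨⟨x, hx, hxq⟩, y, hy, hqy⟩
  exact ⟨⟨x, Or.inl hx, hxq⟩, y, Or.inr hy, hqy⟩

/-- A closed order is locally convex on compact sets. -/
theorem exists_isClosed_nhds_convex_subset {M : Type*} [TopologicalSpace M] [RegularSpace M]
    {J : M → M → Prop} (hJ : IsClosed {p : M × M | J p.1 p.2})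
    (hanti : ∀ x y, J x y → J y x → x = y) {K : Set M} (hK : IsCompact K) {x : M} {U : Set M}
    (hU : U ∈ 𝓝 x) :
    ∃ V ∈ 𝓝 x, IsClosed V ∧ ∀ u ∈ V, ∀ w ∈ V, ∀ v ∈ K, J u v → J v w → v ∈ U := by
  -- By antisymmetry no `v` in this compact set lies causally between `x` and `x`. This is an open
  -- condition on the endpoints and `v`, so compactness makes it hold for all endpoints near `x`.
  have hL : IsCompact (K \ interior U) := hK.diff isOpen_interior
  have key := hL.eventually_forall_of_forall_eventually (x₀ := (x, x))
    (P := fun (q : M × M) v => ¬ (J q.1 v ∧ J v q.2)) fun v hv => by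
      have hc : IsClosed {z : (M × M) × M | J z.1.1 z.2 ∧ J z.2 z.1.2} :=
        (hJ.preimage (f := fun z : (M × M) × M => (z.1.1, z.2)) (by fun_prop)).inter
          (hJ.preimage (f := fun z : (M × M) × M => (z.2, z.1.2)) (by fun_prop))
      refine hc.isOpen_compl.mem_nhds fun h => hv.2 ?_
      rw [← hanti x v h.1 h.2]
      exact mem_interior_iff_mem_nhds.2 hU
  obtain ⟨W, hW, hWp⟩ := (eventually_prod_self_iff (r := fun q q' : M =>
    ∀ v ∈ K \ interior U, ¬ (J q v ∧ J v q'))).1 (by rwa [← nhds_prod_eq])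
  obtain ⟨V, hV, hVc, hVW⟩ := exists_mem_nhds_isClosed_subset hW
  refine ⟨V, hV, hVc, fun u hu w hw v hv huv hvw => ?_⟩
  by_contra hvU
  exact hWp u (hVW hu) w (hVW hw) v ⟨hv, fun h => hvU (interior_subset h)⟩ ⟨huv, hvw⟩

/-! ### Closed orders are non-totally imprisoning -/

section MetricSpace

variable {M : Type*} [MetricSpace M] {R J : M → M → Prop}

/-- Between any two parameters at which the curve is in `V x`, convexity keeps it in `U x`. The
bound `C x` thus covers everything from the first to the last visit, however often the curve leaves
`V x`. -/
theorem isNonTotallyImprisoning_of_isClosed (hJ : IsClosed {p : M × M | J p.1 p.2})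
    (hrefl : ∀ x, J x x) (hanti : ∀ x y, J x y → J y x → x = y) (hcomp : IsMetricCompatible J) :
    IsNonTotallyImprisoning J := by
  intro K hK
  choose U hU C hC using hcomp
  choose V hV hVc hVU using fun x => exists_isClosed_nhds_convex_subset hJ hanti hK (hU x)
  obtain ⟨F, -, hF⟩ := hK.elim_nhds_subcover V fun x _ => hV x
  refine ⟨∑ x ∈ F, C x, fun s γ hγ hsK => ?_⟩
  -- The interval `s` need not be compact, so the bound is proved on its compact subintervals.
  rw [eVariationOn.eq_biSup_inter_Icc]
  refine iSup₂_le fun ⟨a, b⟩ ⟨ha, hb, hab⟩ => ?_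
  have hs : Icc a b ⊆ s := hγ.ordConnected.out ha hb
  have hle : ∀ u ∈ s, ∀ v ∈ s, u ≤ v → J (γ u) (γ v) := fun u hu v hv huv =>
    huv.eq_or_lt.elim (fun h => h ▸ hrefl _) (hγ.related u hu v hv)
  have hcont : ContinuousOn γ (Icc a b) := hγ.locallyLipschitz.continuousOn.mono hs
  simp only [inter_eq_self_of_subset_right hs]
  push_cast
  refine eVariationOn_Icc_le_sum_of_closed_cover γ (fun x => Icc a b ∩ γ ⁻¹' V x)
    (fun x => hcont.preimage_isClosed_of_isClosed isClosed_Icc (hVc x)) (fun x => C x) ?_ b F a ?_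
  · rintro x u ⟨hu, huV⟩ v ⟨hv, hvV⟩ huv
    have huvs : Icc u v ⊆ s := (Icc_subset_Icc hu.1 hv.2).trans hs
    -- Causal curves are nonconstant by definition, so constant segments are treated apart.
    by_cases hconst : ∃ t₁ ∈ Icc u v, ∃ t₂ ∈ Icc u v, γ t₁ ≠ γ t₂
    · refine hC x (Icc u v) γ ⟨ordConnected_Icc, hconst, hγ.locallyLipschitz.mono huvs,
        fun t₁ h₁ t₂ h₂ => hγ.related t₁ (huvs h₁) t₂ (huvs h₂)⟩ ?_
      rintro _ ⟨t, ht, rfl⟩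
      exact hVU x _ huV _ hvV _ (hsK ⟨t, huvs ht, rfl⟩) (hle u (hs hu) t (huvs ht) ht.1)
        (hle t (huvs ht) v (hs hv) ht.2)
    · push Not at hconst
      rw [eVariationOn.constant_on]
      · exact zero_le
      · rintro _ ⟨t₁, h₁, rfl⟩ _ ⟨t₂, h₂, rfl⟩
        exact hconst t₁ h₁ t₂ h₂
  · intro t ht
    obtain ⟨x, hx, hxV⟩ : ∃ x ∈ F, γ t ∈ V x := by simpa using hF (hsK ⟨t, hs ht, rfl⟩)
    exact mem_biUnion hx ⟨ht, hxV⟩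

/-! ### Concatenation of curves -/

theorem IsDirectedCurveFrom.exists_translate {a b : ℝ} {γ : ℝ → M} {x y : M}
    (h : IsDirectedCurveFrom R a b γ x y) (c : ℝ) :
    ∃ (d : ℝ) (σ : ℝ → M), IsDirectedCurveFrom R c d σ x y ∧
      σ '' Icc c d = γ '' Icc a b := by
  obtain ⟨hab, hγ, hx, hy⟩ := h
  have hmaps : MapsTo (fun t => t - (c - a)) (Icc c (b + (c - a))) (Icc a b) := fun t ht =>
    ⟨by linarith [ht.1], by linarith [ht.2]⟩
  refine ⟨b + (c - a), fun t => γ (t - (c - a)), ⟨by linarith, ⟨ordConnected_Icc, ?_, ?_, ?_⟩,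
    by simp [hx], by simp [hy]⟩, ?_⟩
  · obtain ⟨t₁, h₁, t₂, h₂, hne⟩ := hγ.nonconstant
    exact ⟨t₁ + (c - a), ⟨by linarith [h₁.1], by linarith [h₁.2]⟩, t₂ + (c - a),
      ⟨by linarith [h₂.1], by linarith [h₂.2]⟩, by simpa using hne⟩
  · intro t ht
    obtain ⟨K, N, hN, hK⟩ := hγ.locallyLipschitz (hmaps ht)
    have hcont : Continuous fun t : ℝ => t - (c - a) := by fun_prop
    refine ⟨K, _, hcont.continuousWithinAt.tendsto_nhdsWithin hmaps hN, fun u hu v hv => ?_⟩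
    simpa using hK hu hv
  · exact fun t₁ h₁ t₂ h₂ hlt => hγ.related _ (hmaps h₁) _ (hmaps h₂) (by linarith)
  · ext z
    constructor
    · rintro ⟨t, ht, rfl⟩
      exact ⟨_, hmaps ht, rfl⟩
    · rintro ⟨t, ht, rfl⟩
      exact ⟨t + (c - a), ⟨by linarith [ht.1], by linarith [ht.2]⟩, by simp⟩

theorem IsDirectedCurveFrom.exists_concat (htrans : ∀ x y z, R x y → R y z → R x z) {a b c : ℝ}
    {γ σ : ℝ → M} {x y z : M} (h₁ : IsDirectedCurveFrom R a b γ x y)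
    (h₂ : IsDirectedCurveFrom R b c σ y z) :
    ∃ τ : ℝ → M, IsDirectedCurveFrom R a c τ x z ∧ EqOn γ τ (Icc a b) ∧ EqOn σ τ (Icc b c) := by
  obtain ⟨hab, hγ, hx, hy⟩ := h₁
  obtain ⟨hbc, hσ, hy', hz⟩ := h₂
  set τ : ℝ → M := fun t => if t ≤ b then γ t else σ t with hτ
  have e₁ : EqOn γ τ (Icc a b) := fun t ht => by simp [hτ, ht.2]
  have e₂ : EqOn σ τ (Icc b c) := fun t ht => by
    rcases ht.1.eq_or_lt with rfl | h
    · simp [hτ, hy, hy']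
    · simp [hτ, not_le.2 h]
  refine ⟨τ, ⟨hab.trans hbc, ⟨ordConnected_Icc, ?_, ?_, ?_⟩, ?_, ?_⟩, e₁, e₂⟩
  · obtain ⟨t₁, h₁, t₂, h₂, hne⟩ := hγ.nonconstant
    exact ⟨t₁, Icc_subset_Icc_right hbc.le h₁, t₂, Icc_subset_Icc_right hbc.le h₂,
      by rwa [← e₁ h₁, ← e₁ h₂]⟩
  · exact .Icc_concat hab.le hbc.le (hγ.locallyLipschitz.congr_of_eqOn e₁)
      (hσ.locallyLipschitz.congr_of_eqOn e₂)
  · have r₁ : ∀ s ∈ Icc a b, ∀ t ∈ Icc a b, s < t → R (τ s) (τ t) := fun s hs t ht hst => by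
      rw [← e₁ hs, ← e₁ ht]
      exact hγ.related s hs t ht hst
    have r₂ : ∀ s ∈ Icc b c, ∀ t ∈ Icc b c, s < t → R (τ s) (τ t) := fun s hs t ht hst => by
      rw [← e₂ hs, ← e₂ ht]
      exact hσ.related s hs t ht hst
    intro s hs t ht hst
    rcases le_or_gt t b with htb | hbt
    · exact r₁ s ⟨hs.1, hst.le.trans htb⟩ t ⟨ht.1, htb⟩ hst
    rcases le_or_gt b s with hbs | hsb
    · exact r₂ s ⟨hbs, hs.2⟩ t ⟨hbt.le, ht.2⟩ hst
    · exact htrans _ _ _ (r₁ s ⟨hs.1, hsb.le⟩ b (right_mem_Icc.2 hab.le) hsb)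
        (r₂ b (left_mem_Icc.2 hbc.le) t ⟨hbt.le, ht.2⟩ hbt)
  · rw [← e₁ (left_mem_Icc.2 hab.le), hx]
  · rw [← e₂ (right_mem_Icc.2 hbc.le), hz]

/-- A directed curve from `x` to `y` followed by one from `y` to `x` can be run through any number
of times. -/
theorem exists_long_closed_curve (htrans : ∀ x y z, R x y → R y z → R x z) {a b a' b' : ℝ}
    {γ σ : ℝ → M} {x y : M} (hγ : IsDirectedCurveFrom R a b γ x y)
    (hσ : IsDirectedCurveFrom R a' b' σ y x) (n : ℕ) :
    ∃ (c d : ℝ) (τ : ℝ → M), IsDirectedCurveFrom R c d τ x x ∧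
      τ '' Icc c d ⊆ γ '' Icc a b ∪ σ '' Icc a' b' ∧
      (n + 1) * edist x y ≤ eVariationOn τ (Icc c d) := by
  obtain ⟨d₁, σ₁, hσ₁, hi₁⟩ := hσ.exists_translate b
  obtain ⟨β, hβ, e₁, e₂⟩ := hγ.exists_concat htrans hσ₁
  have hβi : β '' Icc a d₁ ⊆ γ '' Icc a b ∪ σ '' Icc a' b' := by
    rw [← Icc_union_Icc_eq_Icc hγ.1.le hσ₁.1.le, image_union, ← e₁.image_eq, ← e₂.image_eq, hi₁]
  have hyβ : y ∈ β '' Icc a d₁ :=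
    ⟨b, ⟨hγ.1.le, hσ₁.1.le⟩, by rw [← e₁ (right_mem_Icc.2 hγ.1.le), hγ.2.2.2]⟩
  -- Stage `n` makes `n + 1` turns of the loop `β`; each turn passes through `x` and `y` and so
  -- contributes at least `edist x y`.
  induction n with
  | zero =>
    refine ⟨a, d₁, β, hβ, hβi, ?_⟩
    obtain ⟨t, ht, rfl⟩ := hyβ
    conv_lhs => rw [← hβ.2.2.1]
    simpa using eVariationOn.edist_le β (left_mem_Icc.2 hβ.1.le) ht
  | succ n ih =>
    obtain ⟨c, d, τ, hτ, hτi, hlen⟩ := ih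
    obtain ⟨d₂, β₂, hβ₂, hi₂⟩ := hβ.exists_translate d
    obtain ⟨υ, hυ, f₁, f₂⟩ := hτ.exists_concat htrans hβ₂
    refine ⟨c, d₂, υ, hυ, ?_, ?_⟩
    · rw [← Icc_union_Icc_eq_Icc hτ.1.le hβ₂.1.le, image_union, ← f₁.image_eq, ← f₂.image_eq, hi₂]
      exact union_subset hτi hβi
    · have hsplit := eVariationOn.Icc_add_Icc υ (s := univ) hτ.1.le hβ₂.1.le (mem_univ d)
      simp only [univ_inter] at hsplit
      rw [← hsplit, ← eVariationOn.eq_of_eqOn f₁, ← eVariationOn.eq_of_eqOn f₂]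
      have : edist x y ≤ eVariationOn β₂ (Icc d d₂) := by
        rw [← hi₂] at hyβ
        obtain ⟨t, ht, hty⟩ := hyβ
        rw [← hty]
        conv_lhs => rw [← hβ₂.2.2.1]
        exact eVariationOn.edist_le β₂ (left_mem_Icc.2 hβ₂.1.le) ht
      rw [Nat.cast_succ, add_mul _ 1, one_mul]
      exact add_le_add hlen this

/-- Two distinct points related both ways lie on a closed causal curve with compact image; enough
turns of it exceed any length bound. -/
theorem IsNonTotallyImprisoning.antisymm (h : IsNonTotallyImprisoning J)
    (htrans : ∀ x y z, J x y → J y z → J x z)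
    (hconn : ∀ x y, J x y → x ≠ y → ∃ (a b : ℝ) (γ : ℝ → M), IsDirectedCurveFrom J a b γ x y)
    {x y : M} (hxy : J x y) (hyx : J y x) : x = y := by
  by_contra hne
  obtain ⟨a, b, γ, hγ⟩ := hconn x y hxy hne
  obtain ⟨a', b', σ, hσ⟩ := hconn y x hyx (Ne.symm hne)
  obtain ⟨C, hC⟩ := h (γ '' Icc a b ∪ σ '' Icc a' b')
    ((isCompact_Icc.image_of_continuousOn hγ.2.1.locallyLipschitz.continuousOn).union
      (isCompact_Icc.image_of_continuousOn hσ.2.1.locallyLipschitz.continuousOn))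
  obtain ⟨n, hn⟩ := ENNReal.exists_nat_mul_gt (a := edist x y) (b := C)
    (edist_pos.2 hne).ne' ENNReal.coe_ne_top
  obtain ⟨c, d, τ, hτ, hi, hlen⟩ := exists_long_closed_curve htrans hγ hσ n
  refine (hn.trans_le ?_).not_ge (hlen.trans (hC _ τ hτ.2.1 hi))
  gcongr
  exact le_self_add

/-- If the causal emeralds are compact, the causal relation is closed. -/
theorem isClosed_of_isCompact_emerald (hrefl : ∀ x, J x x)
    (h : ∀ K₁ K₂ : Set M, IsCompact K₁ → IsCompact K₂ →
      IsCompact (CausalFuture J K₁ ∩ CausalPast J K₂)) :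
    IsClosed {p : M × M | J p.1 p.2} := by
  refine IsSeqClosed.isClosed fun u z hu hz => ?_
  obtain ⟨p, q⟩ := z
  have hp : Tendsto (fun n => (u n).1) atTop (𝓝 p) := (continuous_fst.tendsto _).comp hz
  have hq : Tendsto (fun n => (u n).2) atTop (𝓝 q) := (continuous_snd.tendsto _).comp hz
  -- The emerald of the two tails with their limits is closed and contains the second components,
  -- hence `q`. So `q` is in the future of `p` or of a tail point; varying `m` gives the latter for
  -- infinitely many indices unless `J p q`.
  have key : ∀ m, J p q ∨ ∃ n, J (u (n + m)).1 q := by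
    intro m
    have hp' := (tendsto_add_atTop_iff_nat m).2 hp
    have hq' := (tendsto_add_atTop_iff_nat m).2 hq
    have hE := h _ _ hp'.isCompact_insert_range hq'.isCompact_insert_range
    obtain ⟨⟨x, hx, hxq⟩, -⟩ := hE.isClosed.mem_of_tendsto hq' (.of_forall fun n =>
      ⟨⟨_, Or.inr ⟨n, rfl⟩, hu (n + m)⟩, _, Or.inr ⟨n, rfl⟩, hrefl _⟩)
    rcases hx with rfl | ⟨n, rfl⟩
    · exact Or.inl hxq
    · exact Or.inr ⟨n, hxq⟩
  by_contra hpq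
  have hfreq : ∃ᶠ n in atTop, J (u n).1 q := frequently_atTop.2 fun m =>
    let ⟨n, hn⟩ := (key m).resolve_left hpq
    ⟨n + m, Nat.le_add_left _ _, hn⟩
  -- With `q` now fixed, infinitely many first components lie in this closed emerald, so their limit
  -- `p` does too.
  have hE := h _ _ hp.isCompact_insert_range (isCompact_singleton (x := q))
  obtain ⟨-, y, rfl, hy⟩ := hE.isClosed.mem_of_frequently_of_tendsto
    (hfreq.mono fun n hn => ⟨⟨_, Or.inr ⟨n, rfl⟩, hrefl _⟩, q, rfl, hn⟩) hp
  exact hpq hy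

theorem isGloballyHyperbolic_iff_isKGloballyHyperbolic (hrefl : ∀ x, J x x)
    (htrans : ∀ x y z, J x y → J y z → J x z)
    (hconn : ∀ x y, J x y → x ≠ y → ∃ (a b : ℝ) (γ : ℝ → M), IsDirectedCurveFrom J a b γ x y)
    (hcomp : IsMetricCompatible J) : IsGloballyHyperbolic J ↔ IsKGloballyHyperbolic J := by
  constructor
  · intro h
    exact ⟨isNonTotallyImprisoning_of_isClosed h.1 hrefl (fun x y => h.2.1.antisymm x y) hcomp,
      fun K₁ K₂ h₁ h₂ => h.isCompact_emerald h₁ h₂⟩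
  · rintro ⟨him, hem⟩
    exact ⟨isClosed_of_isCompact_emerald hrefl hem,
      { refl := hrefl
        trans := htrans
        antisymm := fun x y => him.antisymm htrans hconn },
      fun K hK => hem K K hK hK⟩

theorem IsLocalizable.isMetricCompatible {I : M → M → Prop} {d : M → M → ℝ≥0∞}
    (h : IsLocalizable I J d) : IsMetricCompatible J := fun x =>
  let ⟨Ω, hx, hΩ⟩ := h x
  ⟨Ω, hΩ.1.mem_nhds hx, hΩ.2.1⟩

end MetricSpace

namespace LorentzianPreLengthSpace

variable {M : Type*}

theorem globallyHyperbolic_iff_kGloballyHyperbolic (S : LorentzianPreLengthSpace M)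
    (hconn : S.CausallyPathConnected) (hcomp : S.RhoCompatible) :
    S.GloballyHyperbolic ↔ S.KGloballyHyperbolic :=
  letI := S.ρ
  isGloballyHyperbolic_iff_isKGloballyHyperbolic S.isPreLength.causal_refl
    S.isPreLength.causal_trans hconn.2 hcomp

theorem IsLengthSpace.rhoCompatible {S : LorentzianPreLengthSpace M} (h : S.IsLengthSpace) :
    S.RhoCompatible :=
  letI := S.ρ
  IsLocalizable.isMetricCompatible h.2.2.1

end LorentzianPreLengthSpace

theorem mainTheorem4 {M : Type*} :
    -- the equivalence for causally path connected, ρ-compatible Lorentzian pre-length spaces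
    (∀ S : LorentzianPreLengthSpace M, S.CausallyPathConnected → S.RhoCompatible →
      (S.GloballyHyperbolic ↔ S.KGloballyHyperbolic)) ∧
    -- Lorentzian length spaces are among these
    (∀ S : LorentzianPreLengthSpace M, S.IsLengthSpace →
      S.CausallyPathConnected ∧ S.RhoCompatible ∧
        (S.GloballyHyperbolic ↔ S.KGloballyHyperbolic)) ∧
    -- K-global hyperbolicity depends only on the topology and on J
    (∀ S₁ S₂ : LorentzianPreLengthSpace M,
      S₁.CausallyPathConnected → S₁.RhoCompatible →
      S₂.CausallyPathConnected → S₂.RhoCompatible →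
      S₁.topology = S₂.topology → S₁.J = S₂.J →
      (S₁.KGloballyHyperbolic ↔ S₂.KGloballyHyperbolic)) := by
  refine ⟨fun S => S.globallyHyperbolic_iff_kGloballyHyperbolic, fun S hS => ?_, ?_⟩
  · exact ⟨hS.2.1, hS.rhoCompatible,
      S.globallyHyperbolic_iff_kGloballyHyperbolic hS.2.1 hS.rhoCompatible⟩
  · intro S₁ S₂ hc₁ hr₁ hc₂ hr₂ hT hJ
    -- Passing to (⋆) on both sides removes the metrics: only the topology and `J` remain.
    rw [← S₁.globallyHyperbolic_iff_kGloballyHyperbolic hc₁ hr₁,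
      ← S₂.globallyHyperbolic_iff_kGloballyHyperbolic hc₂ hr₂,
      LorentzianPreLengthSpace.GloballyHyperbolic, LorentzianPreLengthSpace.GloballyHyperbolic,
      hT, hJ]
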